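/- Let $n\ge 1$, let $U_1,\dots,U_n$ be finite sets with $|U_i|=u_i\ge 2$, put $X=U_1\times\cdots\times U_n$, fix $x\in X$, and let $F$ be a field of characteristic $p\ge 0$ (for $p=0$, $p\nmid k$ means $k\ne 0$). For a subset $g\subseteq\{1,\dots,n\}$ let $R_g$ be the set of the pairs $(y,z)\in X\times X$ such that $y_i\neq z_i$ exactly for $i\in g$. (The $2^n$ relations $R_g$ form the factorial association scheme with parameters $u_1,\dots,u_n$.) Let $k_g=|\{y\in X:(x,y)\in R_g\}|$ be the valency of $R_g$. Let $A_g\in M_X(F)$ be the adjacency matrix of $R_g$, and let $E_g^*\in M_X(F)$ be the diagonal $0/1$-matrix with $(y,y)$-entry $1$ if and only if $(x,y)\in R_g$. The Terwilliger $F$-algebra $T$ of the scheme with respect to $x$ is the unital subalgebra of $M_X(F)$ generated by all the $A_g$ and all the $E_g^*$; let $\mathrm{Rad}(T)$ be its Jacobson radical. For $g,h\subseteq\{1,\dots,n\}$ put $\widetilde g=\{i\in g:u_i>2\}$, $g\oplus h=(g\setminus h)\cup(h\setminus g)$ and $g\odot h=(g\oplus h)\cup\widetilde{g\cap h}$. Let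 $$D=\{(a,b,c): a\oplus b\subseteq c\subseteq a\odot b,\ p\nmid k_b\},$$ and for $(g,h,i),(j,k,\ell)\in D$ write $(g,h,i)\approx(j,k,\ell)$ if and only if $\widetilde{g\cap i}\setminus h=\widetilde{j\cap\ell}\setminus k$; this is an equivalence relation on $D$. Let $D_1,\dots,D_{n_\approx}$ be its equivalence classes, and put $D(m)=\{a:(a,b,a)\in D_m\text{ for some }b\}$ for $1\le m\le n_\approx$. Theorem 9.13. There is an isomorphism of $F$-algebras $$T/\mathrm{Rad}(T)\cong\bigoplus_{m=1}^{n_\approx}M_{|D(m)|}(F).$$ Moreover, the number of isomorphism classes of irreducible left $T$-modules equals $n_\approx$. In particular, this number does not depend on $F$: for every field $K$, of any characteristic, the Terwilliger $K$-algebra of the same scheme with respect to $x$ has the same number of isomorphism classes of irreducible left modules. -/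

import Mathlib

universe u v w

section Terwilliger

variable {X I : Type*}

/-- The adjacency `F`-matrix of the relation `R g` on `X`. -/
noncomputable def adjacencyMatrix (F : Type*) [Field F] (R : I → X → X → Prop) (g : I) :
    Matrix X X F := by
  classical
  exact Matrix.of fun y z => if R g y z then 1 else 0

/-- The dual `F`-idempotent `E_g^*(x)`: the diagonal `0/1`-matrix supported on
`x R_g = {y : (x, y) ∈ R_g}`. -/
noncomputable def dualIdempotent (F : Type*) [Field F] (R : I → X → X → Prop) (x : X) (g : I) :
    Matrix X X F := by
  classical
  exact Matrix.diagonal fun y => if R g x y then 1 else 0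

/-- The Terwilliger `F`-algebra with respect to `x` of a scheme with relations `R g`, `g : I`: the
(unital) subalgebra of the full matrix algebra generated by all the adjacency matrices and all
the dual idempotents with respect to `x`. -/
noncomputable def terwilligerAlgebra [Fintype X] [DecidableEq X] (F : Type*) [Field F]
    (R : I → X → X → Prop) (x : X) : Subalgebra F (Matrix X X F) :=
  Algebra.adjoin F (Set.range (dualIdempotent F R x) ∪ Set.range (adjacencyMatrix F R))

/-- The valency `k_g = |x R_g|` of the relation `R g` (for a scheme, it is the same for all `x`). -/
noncomputable def valency (R : I → X → X → Prop) (x : X) (g : I) : ℕ :=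
  {y | R g x y}.ncard

end Terwilliger

section Irreducible

/-- Isomorphism of irreducible left `A`-modules. Every irreducible `A`-module is isomorphic to a
quotient of `A`, so the modules in the universe of `A` represent all of them. -/
def irreducibleModuleSetoid (A : Type u) [Ring A] :
    Setoid {M : ModuleCat.{u} A // IsSimpleModule A M} where
  r M N := Nonempty (M.1 ≃ₗ[A] N.1)
  iseqv :=
    ⟨fun _ => ⟨LinearEquiv.refl _ _⟩, fun ⟨e⟩ => ⟨e.symm⟩, fun ⟨e⟩ ⟨f⟩ => ⟨e.trans f⟩⟩

/-- The number of isomorphism classes of irreducible left `A`-modules (`0` if there are infinitely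
many). -/
noncomputable def numIrreducibleModules (A : Type u) [Ring A] : ℕ :=
  Nat.card (Quotient (irreducibleModuleSetoid A))

end Irreducible

namespace FactorialScheme

variable {n : ℕ} {U : Fin n → Type u}

/- The relations `R_g`, `0 ≤ g ≤ 2 ^ n - 1`, of a factorial scheme are indexed here by the set
`P(g)` of the positions of the binary digits `1` of `g`, that is, by an arbitrary subset of the
`n` coordinates; `≤₂` is then inclusion of subsets. -/

/-- The relation `R_g` of the factorial scheme on `∏ i, U i`: the points `y` and `z` differ exactly
at the coordinates in `g`. -/
def rel (U : Fin n → Type u) (g : Finset (Fin n)) (y z : ∀ i, U i) : Prop :=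
  ∀ i, y i ≠ z i ↔ i ∈ g

/-- The Terwilliger `F`-algebra of the factorial scheme on `∏ i, U i` with respect to `x`. -/
noncomputable def algebra (F : Type v) [Field F] [∀ i, Fintype (U i)] [∀ i, DecidableEq (U i)]
    (x : ∀ i, U i) : Subalgebra F (Matrix (∀ i, U i) (∀ i, U i) F) :=
  terwilligerAlgebra F (rel U) x

/-- `g̃`: the coordinates in `g` at which `U i` has more than two elements. -/
def tilde (U : Fin n → Type u) [∀ i, Fintype (U i)] (g : Finset (Fin n)) : Finset (Fin n) :=
  g.filter fun i => 2 < Fintype.card (U i)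

/-- `g ⊕ h = (g \ h) ∪ (h \ g)`. -/
def oplus (g h : Finset (Fin n)) : Finset (Fin n) := (g \ h) ∪ (h \ g)

/-- `g ⊙ h = (g ⊕ h) ∪ (g ∩ h)~`. -/
def odot (U : Fin n → Type u) [∀ i, Fintype (U i)] (g h : Finset (Fin n)) : Finset (Fin n) :=
  oplus g h ∪ tilde U (g ∩ h)

/-- The set `𝔻` of the triples `(a, b, c)` with `a ⊕ b ≤₂ c ≤₂ a ⊙ b` and `p ∤ k_b`. -/
def triples [∀ i, Fintype (U i)] (p : ℕ) (x : ∀ i, U i) :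
    Set (Finset (Fin n) × Finset (Fin n) × Finset (Fin n)) :=
  {t | oplus t.1 t.2.1 ⊆ t.2.2 ∧ t.2.2 ⊆ odot U t.1 t.2.1 ∧ ¬ p ∣ valency (rel U) x t.2.1}

/-- The equivalence relation `≈` on `𝔻`: `(g, h, i) ≈ (j, k, l)` if and only if
`(g ∩ i)~ \ h = (j ∩ l)~ \ k`. -/
def tripleSetoid [∀ i, Fintype (U i)] (p : ℕ) (x : ∀ i, U i) : Setoid (triples p x) where
  r s t := tilde U (s.1.1 ∩ s.1.2.2) \ s.1.2.1 = tilde U (t.1.1 ∩ t.1.2.2) \ t.1.2.1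
  iseqv := ⟨fun _ => rfl, fun h => h.symm, fun h h' => h.trans h'⟩

/-- The set of the equivalence classes of `𝔻` with respect to `≈`. -/
abbrev TripleClass [∀ i, Fintype (U i)] (p : ℕ) (x : ∀ i, U i) : Type :=
  Quotient (tripleSetoid p x)

/-- `n_≈`, the number of the equivalence classes of `𝔻` with respect to `≈`. -/
noncomputable def numClasses [∀ i, Fintype (U i)] (p : ℕ) (x : ∀ i, U i) : ℕ :=
  Nat.card (TripleClass p x)

/-- `𝔻(m)` for the equivalence class `m`: the `a` such that `(a, b, a)` lies in `m` for some `b`. -/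
def diagIndices [∀ i, Fintype (U i)] (p : ℕ) (x : ∀ i, U i) (m : TripleClass p x) :
    Set (Finset (Fin n)) :=
  {a | ∃ (b : Finset (Fin n)) (h : (a, b, a) ∈ triples p x),
    Quotient.mk (tripleSetoid p x) ⟨(a, b, a), h⟩ = m}

end FactorialScheme

/-! `T` is spanned by Kronecker products of matrices from one small algebra per coordinate: the
matrices on `U i` that are constant on the equality patterns of `x i`, `y`, `z`
(`toSubmodule_algebra`). So the question reduces to a single coordinate. Write `u = |U i|`. A matrix
of the small algebra acts on the span of the point `x i` and the indicator of its complement, and by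
a scalar on the sum-zero vectors supported off `x i`; the latter matter only if `u > 2`. If `u - 1 ≠
0` in `F`, this gives a faithful map onto `M_2`, times `F` when `u > 2`. If `u - 1 = 0`, the
indicator itself has sum zero, the 2×2 action is triangular, the quotient is `F × F`, and any three
elements of the kernel have product zero. Tensoring these quotients maps `T` onto a product of
matrix algebras. The kernel is a sum of nil left ideals, one per coordinate, so it lies in the
radical; it equals the radical because the target is semisimple (`exists_algHom`). The blocks
correspond to the subsets of `{i : u_i > 2}`, whatever `F` is. A class of triples is determined by
its subset `s`, and `D(m)` consists of the `a ⊇ s` whose coordinates outside `s` satisfy `p ∤ u_i -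
1`, which are the row indices of the block. -/

set_option linter.unusedSectionVars false

/-! ### Radical and simple modules of a ring mapped onto a product of matrix rings -/

section MatrixQuotients

variable {A : Type u} [Ring A]

/-- Nilpotency of `y * x` makes `1 + y * x` invertible, which is the quasi-regularity criterion for
the radical. -/
theorem mem_ringJacobson_of_forall_isNilpotent {x : A} (h : ∀ y, IsNilpotent (y * x)) :
    x ∈ Ring.jacobson A := by
  rw [← Ideal.jacobson_bot, Ideal.mem_jacobson_iff]
  intro y
  obtain ⟨u, hu⟩ := (h y).isUnit_one_add
  refine ⟨(u⁻¹ : Aˣ), ?_⟩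
  have h1 : ((u⁻¹ : Aˣ) : A) * (1 + y * x) = 1 := by rw [← hu, Units.inv_mul]
  rw [Ideal.mem_bot, mul_assoc, sub_eq_zero, add_comm, ← h1, mul_add, mul_one]

theorem smul_eq_zero_of_mem_ringJacobson {M : Type*} [AddCommGroup M] [Module A M]
    [IsSimpleModule A M] {a : A} (ha : a ∈ Ring.jacobson A) (v : M) : a • v = 0 := by
  have h := Module.le_comap_jacobson (LinearMap.toSpanSingleton A M v) ha
  rw [Submodule.mem_comap, LinearMap.toSpanSingleton_apply] at h
  have h0 : Module.jacobson A M = ⊥ := by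
    refine le_bot_iff.mp (sInf_le ?_)
    exact isCoatom_bot
  rw [h0] at h
  exact (Submodule.mem_bot A).mp h

variable {F : Type*} [Field F] {ι : Type*} {J : ι → Type*}
  [∀ m, Fintype (J m)] [∀ m, DecidableEq (J m)]

/-- The left ideal of the elements whose image in the `m`-th matrix ring has zero `j`-th column. -/
def columnIdeal (Φ : A →+* ∀ m, Matrix (J m) (J m) F) (m : ι) (j : J m) : Ideal A where
  carrier := {a | ∀ i, Φ a m i j = 0}
  add_mem' ha hb i := by simp [ha i, hb i]
  zero_mem' i := by simp
  smul_mem' c a ha i := by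
    simp only [smul_eq_mul, map_mul, Pi.mul_apply, Matrix.mul_apply]
    exact Finset.sum_eq_zero fun k _ => by rw [ha k, mul_zero]

theorem mem_columnIdeal {Φ : A →+* ∀ m, Matrix (J m) (J m) F} {m : ι} {j : J m} {a : A} :
    a ∈ columnIdeal Φ m j ↔ ∀ i, Φ a m i j = 0 := Iff.rfl

theorem nonempty_quotient_ringJacobson_algEquiv [Fintype ι] [Algebra F A]
    (Φ : A →ₐ[F] ∀ m, Matrix (J m) (J m) F)
    (hΦ : Function.Surjective Φ) (hker : ∀ a, Φ a = 0 → a ∈ Ring.jacobson A) :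
    Nonempty ((A ⧸ Ring.jacobson A) ≃ₐ[F] ∀ m, Matrix (J m) (J m) F) := by
  have : RingHomSurjective (Φ : A →+* ∀ m, Matrix (J m) (J m) F) := ⟨hΦ⟩
  have hk : Ring.jacobson A = RingHom.ker Φ := by
    refine le_antisymm (fun a ha => ?_) hker
    have h := Ring.le_comap_jacobson (Φ : A →+* ∀ m, Matrix (J m) (J m) F) ha
    rwa [IsSemisimpleRing.jacobson_eq_bot] at h
  exact ⟨(Ideal.quotientEquivAlgOfEq F hk).trans (Ideal.quotientKerAlgEquivOfSurjective hΦ)⟩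

/-- If `Φ a m` has a nonzero entry at `(i, j)`, a lift of a scaled matrix unit moves it to `(j, j)`
with value 1; the result agrees with `1` in column `j`, so any left ideal containing `a` and the
column ideal contains `1`. -/
theorem columnIdeal_isMaximal [DecidableEq ι] {Φ : A →+* ∀ m, Matrix (J m) (J m) F}
    (hΦ : Function.Surjective Φ) (m : ι) (j : J m) : (columnIdeal Φ m j).IsMaximal := by
  rw [Ideal.isMaximal_iff]
  refine ⟨fun h => ?_, fun I a hI ha haI => ?_⟩
  · have := h j
    simp at this
  · rw [mem_columnIdeal, not_forall] at ha
    obtain ⟨i, hi⟩ := ha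
    obtain ⟨b, hb⟩ := hΦ (Pi.single m (Matrix.single j i (Φ a m i j)⁻¹))
    have h1 : b * a - 1 ∈ columnIdeal Φ m j := by
      intro k
      rw [map_sub, map_mul, hb, map_one, Pi.sub_apply, Pi.mul_apply, Pi.single_eq_same,
        Pi.one_apply, Matrix.sub_apply]
      by_cases hk : k = j
      · subst hk
        rw [Matrix.single_mul_apply_same, inv_mul_cancel₀ hi, Matrix.one_apply_eq, sub_self]
      · rw [Matrix.single_mul_apply_of_ne _ _ _ _ _ hk, Matrix.one_apply_ne hk, sub_self]
    have h2 := I.sub_mem (I.mul_mem_left b haI) (hI h1)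
    rwa [sub_sub_cancel] at h2

theorem numIrreducibleModules_eq_card [Fintype ι] [DecidableEq ι]
    (Φ : A →+* ∀ m, Matrix (J m) (J m) F)
    (hΦ : Function.Surjective Φ) (hker : ∀ a, Φ a = 0 → a ∈ Ring.jacobson A)
    (hJ : ∀ m, Nonempty (J m)) : numIrreducibleModules A = Nat.card ι := by
  have j : ∀ m, J m := fun m => (hJ m).some
  choose E hE using fun m (i k : J m) => hΦ (Pi.single m (Matrix.single i k (1 : F)))
  let W (m : ι) : {M : ModuleCat.{u} A // IsSimpleModule A M} :=
    ⟨ModuleCat.of A (A ⧸ columnIdeal Φ m (j m)), isSimpleModule_iff_isCoatom.mpr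
      (Ideal.isMaximal_def.mp (columnIdeal_isMaximal hΦ m (j m)))⟩
  let f : ι → Quotient (irreducibleModuleSetoid A) := fun m => Quotient.mk _ (W m)
  refine (Nat.card_eq_of_bijective f ⟨fun m m' h => ?_, fun q => ?_⟩).symm
  · by_contra hne
    obtain ⟨e⟩ : Nonempty ((A ⧸ columnIdeal Φ m (j m)) ≃ₗ[A] (A ⧸ columnIdeal Φ m' (j m'))) :=
      Quotient.exact h
    -- A lift of a matrix unit of block `m` kills the whole quotient attached to `m'`, but not the
    -- class of `1` in the one attached to `m`.
    obtain ⟨a, ha⟩ := Submodule.mkQ_surjective _ (e (Submodule.Quotient.mk 1))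
    have h1 : E m (j m) (j m) • e (Submodule.Quotient.mk 1) = 0 := by
      rw [← ha, Submodule.mkQ_apply, ← Submodule.Quotient.mk_smul, Submodule.Quotient.mk_eq_zero]
      intro i
      rw [smul_eq_mul, map_mul, hE, Pi.mul_apply, Pi.single_eq_of_ne (Ne.symm hne), zero_mul,
        Matrix.zero_apply]
    rw [← map_smul, LinearEquiv.map_eq_zero_iff, ← Submodule.Quotient.mk_smul,
      Submodule.Quotient.mk_eq_zero] at h1
    have h2 := h1 (j m)
    rw [smul_eq_mul, mul_one, hE, Pi.single_eq_same, Matrix.single_apply_same] at h2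
    exact one_ne_zero h2
  · obtain ⟨⟨M, hM⟩, rfl⟩ := Quotient.exists_rep q
    have : Nontrivial M := IsSimpleModule.nontrivial A M
    obtain ⟨v, hv⟩ := exists_ne (0 : M)
    -- The lifted diagonal units sum to `1` modulo the radical, which kills `M`; hence one of them
    -- moves `v`.
    have hone : Φ (1 - ∑ m, ∑ i, E m i i) = 0 := by
      simp only [map_sub, map_one, map_sum, hE]
      funext m
      rw [Pi.sub_apply, Finset.sum_apply, Finset.sum_eq_single m]
      · simp only [Finset.sum_apply, Pi.single_eq_same, Pi.one_apply, Pi.zero_apply]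
        rw [sub_eq_zero]
        ext i k
        rw [Matrix.sum_apply]
        by_cases hik : i = k
        · subst hik
          simp [Matrix.single_apply]
        · rw [Matrix.one_apply_ne hik, Finset.sum_eq_zero fun l _ => ?_]
          rw [Matrix.single_apply, if_neg fun h => hik (h.1.symm.trans h.2)]
      · intro m' _ hne
        simp [Finset.sum_apply, Pi.single_eq_of_ne (Ne.symm hne)]
      · simp
    obtain ⟨m, i, hmi⟩ : ∃ m i, E m i i • v ≠ 0 := by
      by_contra! h0
      have := smul_eq_zero_of_mem_ringJacobson (hker _ hone) v
      rw [sub_smul, one_smul, Finset.sum_smul, Finset.sum_eq_zero, sub_zero] at this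
      · exact hv this
      · intro m _
        rw [Finset.sum_smul]
        exact Finset.sum_eq_zero fun i _ => h0 m i
    have hw : E m (j m) i • v ≠ 0 := by
      intro h0
      have h1 : Φ (E m i i - E m i (j m) * E m (j m) i) = 0 := by
        rw [map_sub, map_mul, hE, hE, hE, ← Pi.single_mul, Matrix.single_mul_single_same, mul_one,
          sub_self]
      have h2 := smul_eq_zero_of_mem_ringJacobson (hker _ h1) v
      rw [sub_smul, mul_smul, h0, smul_zero, sub_zero] at h2
      exact hmi h2
    -- For `a` in the column ideal, `Φ (a * E m (j m) i) = 0`, so `a ↦ a • E m (j m) i • v` factors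
    -- through the quotient, and a nonzero map of simple modules is bijective.
    have hle : columnIdeal Φ m (j m) ≤
        LinearMap.ker (LinearMap.toSpanSingleton A M (E m (j m) i • v)) := by
      intro a ha
      rw [LinearMap.mem_ker, LinearMap.toSpanSingleton_apply, ← mul_smul]
      refine smul_eq_zero_of_mem_ringJacobson (hker _ ?_) v
      rw [map_mul, hE]
      funext m'
      by_cases hm : m' = m
      · subst hm
        ext k l
        rw [Pi.mul_apply, Pi.single_eq_same, Matrix.mul_apply]
        refine Finset.sum_eq_zero fun j' _ => ?_
        rw [Matrix.single_apply]
        split_ifs with h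
        · rw [← h.1, ha k, zero_mul]
        · rw [mul_zero]
      · rw [Pi.mul_apply, Pi.single_eq_of_ne hm, mul_zero, Pi.zero_apply]
    have hg0 : Submodule.liftQ _ _ hle ≠ 0 := by
      intro h0
      have := LinearMap.congr_fun h0 (Submodule.Quotient.mk 1)
      rw [← Submodule.mkQ_apply, Submodule.mkQ_apply, Submodule.liftQ_apply,
        LinearMap.toSpanSingleton_apply, one_smul] at this
      exact hw this
    have := (W m).2
    exact ⟨m, Quotient.sound ⟨LinearEquiv.ofBijective _
      (LinearMap.bijective_of_ne_zero (M := A ⧸ columnIdeal Φ m (j m)) hg0)⟩⟩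

end MatrixQuotients

/-! ### Tensor products of matrix algebras and of their representations -/

section PiKronecker

variable {ι : Type*} [Fintype ι] {F : Type*} [Field F]

/-- The Kronecker product of a finite family of matrices. -/
def piKronecker {U V : ι → Type*} (M : ∀ i, Matrix (U i) (V i) F) :
    Matrix (∀ i, U i) (∀ i, V i) F :=
  Matrix.of fun y z => ∏ i, M i (y i) (z i)

theorem piKronecker_apply {U V : ι → Type*} (M : ∀ i, Matrix (U i) (V i) F) (y : ∀ i, U i)
    (z : ∀ i, V i) : piKronecker M y z = ∏ i, M i (y i) (z i) := rfl

theorem piKronecker_eq_zero {U V : ι → Type*} {M : ∀ i, Matrix (U i) (V i) F} {i : ι}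
    (h : M i = 0) : piKronecker M = 0 := by
  ext y z
  exact Finset.prod_eq_zero (Finset.mem_univ i) (by rw [h]; rfl)

variable {U : ι → Type*}

theorem piKronecker_one [∀ i, DecidableEq (U i)] : piKronecker (fun i => (1 : Matrix (U i) (U i) F)) = 1 := by
  ext y z
  rw [piKronecker_apply]
  by_cases h : y = z
  · subst h
    simp
  · obtain ⟨i, hi⟩ := Function.ne_iff.mp h
    rw [Matrix.one_apply_ne h]
    exact Finset.prod_eq_zero (Finset.mem_univ i) (Matrix.one_apply_ne hi)

variable [DecidableEq ι]

theorem piKronecker_add (M N : ∀ i, Matrix (U i) (U i) F) :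
    piKronecker (fun i => M i + N i) =
      ∑ s : Finset ι, piKronecker (s.piecewise M N) := by
  ext y z
  simp only [piKronecker_apply, Matrix.add_apply, Matrix.sum_apply, Finset.prod_add,
    Finset.powerset_univ]
  refine Finset.sum_congr rfl fun s _ => ?_
  rw [← Finset.prod_mul_prod_compl s]
  congr 1
  · exact Finset.prod_congr rfl fun i hi => by rw [Finset.piecewise_eq_of_mem _ _ _ hi]
  · rw [← Finset.compl_eq_univ_sdiff]
    exact Finset.prod_congr rfl fun i hi => by
      rw [Finset.piecewise_eq_of_notMem _ _ _ (Finset.mem_compl.mp hi)]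

variable [∀ i, Fintype (U i)]

theorem piKronecker_mul (M N : ∀ i, Matrix (U i) (U i) F) :
    piKronecker M * piKronecker N = piKronecker fun i => M i * N i := by
  ext y z
  simp only [piKronecker_apply, Matrix.mul_apply, Fintype.prod_sum, Finset.prod_mul_distrib]

variable [∀ i, DecidableEq (U i)]

/-- The tensor product of a family of linear functionals on matrix spaces. -/
def piFunctional (f : ∀ i, Matrix (U i) (U i) F →ₗ[F] F) :
    Matrix (∀ i, U i) (∀ i, U i) F →ₗ[F] F where
  toFun X := ∑ y, ∑ z, (∏ i, f i (Matrix.single (y i) (z i) 1)) * X y z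
  map_add' X Y := by simp [mul_add, Finset.sum_add_distrib]
  map_smul' c X := by
    simp only [Matrix.smul_apply, smul_eq_mul, Finset.mul_sum, RingHom.id_apply]
    exact Finset.sum_congr rfl fun _ _ => Finset.sum_congr rfl fun _ _ => by ring

theorem piFunctional_piKronecker (f : ∀ i, Matrix (U i) (U i) F →ₗ[F] F)
    (M : ∀ i, Matrix (U i) (U i) F) : piFunctional f (piKronecker M) = ∏ i, f i (M i) := by
  have h (i : ι) : f i (M i) = ∑ y, ∑ z, f i (Matrix.single y z 1) * M i y z := by
    conv_lhs => rw [Matrix.matrix_eq_sum_single (M i)]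
    simp only [map_sum]
    refine Finset.sum_congr rfl fun y _ => Finset.sum_congr rfl fun z _ => ?_
    rw [← mul_one (M i y z), ← smul_eq_mul, ← Matrix.smul_single, map_smul, smul_eq_mul,
      smul_eq_mul, mul_one, mul_comm]
  simp only [h, Fintype.prod_sum, Finset.prod_mul_distrib]
  rfl

variable (C : ∀ i, Subalgebra F (Matrix (U i) (U i) F))
  {K : ι → Type*} {J : ∀ i, K i → Type*}

/-- The span of the Kronecker products of elements of the given algebras. -/
def piKroneckerSpan : Submodule F (Matrix (∀ i, U i) (∀ i, U i) F) :=
  Submodule.span F {X | ∃ M, (∀ i, M i ∈ C i) ∧ piKronecker M = X}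

/-- The tensor product of linear maps from matrix spaces to products of matrix spaces. -/
def piRepresentation
    (φ : ∀ i, Matrix (U i) (U i) F →ₗ[F] ∀ κ : K i, Matrix (J i κ) (J i κ) F) :
    Matrix (∀ i, U i) (∀ i, U i) F →ₗ[F]
      ∀ κ : ∀ i, K i, Matrix (∀ i, J i (κ i)) (∀ i, J i (κ i)) F where
  toFun X κ := Matrix.of fun α β => piFunctional (fun i =>
    (Matrix.entryLinearMap F F (α i) (β i)).comp ((LinearMap.proj (κ i)).comp (φ i))) X
  map_add' X Y := by
    funext κ
    ext α β
    simp
  map_smul' c X := by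
    funext κ
    ext α β
    simp

variable {C} {φ : ∀ i, Matrix (U i) (U i) F →ₗ[F] ∀ κ : K i, Matrix (J i κ) (J i κ) F}

theorem piRepresentation_piKronecker (M : ∀ i, Matrix (U i) (U i) F) (κ : ∀ i, K i) :
    piRepresentation φ (piKronecker M) κ = piKronecker fun i => φ i (M i) (κ i) := by
  ext α β
  exact piFunctional_piKronecker _ M

variable [∀ i κ, Fintype (J i κ)] [∀ i κ, DecidableEq (J i κ)]

/-- Each `φ i` is linear on all matrices but multiplicative only on `C i`, so the identity holds on
the span of the Kronecker products only. -/
theorem piRepresentation_mul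
    (hmul : ∀ i, ∀ M ∈ C i, ∀ N ∈ C i, φ i (M * N) = φ i M * φ i N)
    {X Y : Matrix (∀ i, U i) (∀ i, U i) F} (hX : X ∈ piKroneckerSpan C)
    (hY : Y ∈ piKroneckerSpan C) :
    piRepresentation φ (X * Y) = piRepresentation φ X * piRepresentation φ Y := by
  induction hX, hY using Submodule.span_induction₂ with
  | mem_mem X Y hX hY =>
    obtain ⟨M, hM, rfl⟩ := hX
    obtain ⟨N, hN, rfl⟩ := hY
    funext κ
    rw [piKronecker_mul, Pi.mul_apply, piRepresentation_piKronecker,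
      piRepresentation_piKronecker, piRepresentation_piKronecker, piKronecker_mul]
    congr 1
    funext i
    rw [hmul i _ (hM i) _ (hN i), Pi.mul_apply]
  | zero_left => simp
  | zero_right => simp
  | add_left X X' Y _ _ _ h h' => rw [add_mul, map_add, map_add, add_mul, h, h']
  | add_right X Y Y' _ _ _ h h' => rw [mul_add, map_add, map_add, mul_add, h, h']
  | smul_left c X Y _ _ h => rw [smul_mul_assoc, map_smul, map_smul, smul_mul_assoc, h]
  | smul_right c X Y _ _ h => rw [mul_smul_comm, map_smul, map_smul, mul_smul_comm, h]

theorem piRepresentation_one (hone : ∀ i, φ i 1 = 1) :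
    piRepresentation φ (1 : Matrix (∀ i, U i) (∀ i, U i) F) = 1 := by
  funext κ
  rw [← piKronecker_one, piRepresentation_piKronecker]
  simp only [hone, Pi.one_apply]
  exact piKronecker_one

/-- The span of the Kronecker products of elements of the given algebras whose factor at `i` is
killed by `φ i`. -/
def coordinateKernel (C : ∀ i, Subalgebra F (Matrix (U i) (U i) F))
    (φ : ∀ i, Matrix (U i) (U i) F →ₗ[F] ∀ κ : K i, Matrix (J i κ) (J i κ) F) (i : ι) :
    Submodule F (Matrix (∀ i, U i) (∀ i, U i) F) :=
  Submodule.span F {X | ∃ M, (∀ i, M i ∈ C i) ∧ φ i (M i) = 0 ∧ piKronecker M = X}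

theorem mul_mem_coordinateKernel
    (hmul : ∀ i, ∀ M ∈ C i, ∀ N ∈ C i, φ i (M * N) = φ i M * φ i N) {i : ι}
    {X Y : Matrix (∀ i, U i) (∀ i, U i) F} (hX : X ∈ piKroneckerSpan C)
    (hY : Y ∈ coordinateKernel C φ i) : X * Y ∈ coordinateKernel C φ i := by
  have h := Submodule.mul_mem_mul hX hY
  rw [piKroneckerSpan, coordinateKernel, Submodule.span_mul_span] at h
  refine Submodule.span_mono ?_ h
  rintro _ ⟨_, ⟨M, hM, rfl⟩, _, ⟨N, hN, hN0, rfl⟩, rfl⟩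
  refine ⟨_, fun k => (C k).mul_mem (hM k) (hN k), ?_, (piKronecker_mul M N).symm⟩
  rw [hmul i _ (hM i) _ (hN i), hN0, mul_zero]

/-- In a product of three spanning elements the factor at `i` vanishes. Three independent matrices
are needed in `hnil` because cubing a sum produces mixed products. -/
theorem pow_three_eq_zero_of_mem_coordinateKernel {i : ι}
    (hnil : ∀ L ∈ C i, ∀ M ∈ C i, ∀ N ∈ C i, φ i L = 0 → φ i M = 0 → φ i N = 0 → L * M * N = 0)
    {X : Matrix (∀ i, U i) (∀ i, U i) F} (hX : X ∈ coordinateKernel C φ i) : X ^ 3 = 0 := by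
  have h := Submodule.mul_mem_mul (Submodule.mul_mem_mul hX hX) hX
  rw [coordinateKernel, Submodule.span_mul_span, Submodule.span_mul_span] at h
  rw [pow_three', ← Submodule.mem_bot F]
  refine Submodule.span_le.mpr ?_ h
  rintro _ ⟨_, ⟨_, ⟨L, hL, hL0, rfl⟩, _, ⟨M, hM, hM0, rfl⟩, rfl⟩, _, ⟨N, hN, hN0, rfl⟩, rfl⟩
  simp only [piKronecker_mul]
  exact piKronecker_eq_zero (hnil _ (hL i) _ (hM i) _ (hN i) hL0 hM0 hN0)

variable [∀ i, Fintype (K i)] [∀ i, DecidableEq (K i)]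

theorem piRepresentation_piKronecker_eq_single {M : ∀ i, Matrix (U i) (U i) F} {κ : ∀ i, K i}
    {α β : ∀ i, J i (κ i)} (hM : ∀ i, φ i (M i) = Pi.single (κ i) (Matrix.single (α i) (β i) 1)) :
    piRepresentation φ (piKronecker M) = Pi.single κ (Matrix.single α β 1) := by
  funext κ'
  rw [piRepresentation_piKronecker]
  simp only [hM]
  by_cases hκ : κ' = κ
  · subst hκ
    ext γ δ
    simp only [piKronecker_apply, Pi.single_eq_same, Matrix.single_apply]
    rw [Finset.prod_ite_zero]
    simp [funext_iff, forall_and]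
  · rw [Pi.single_eq_of_ne hκ]
    obtain ⟨i, hi⟩ := Function.ne_iff.mp hκ
    exact piKronecker_eq_zero (i := i) (Pi.single_eq_of_ne hi _)

/-- The kernel of a tensor product of maps is the sum of the coordinate kernels: replace each factor
`M i` by the combination `S i` of the `B i` with the same image, and expand `S i + (M i - S i)`. -/
theorem sub_sum_mem_iSup_coordinateKernel
    {B : ∀ i (κ : K i), J i κ → J i κ → Matrix (U i) (U i) F} (hBC : ∀ i κ α β, B i κ α β ∈ C i)
    (hB : ∀ i κ α β, φ i (B i κ α β) = Pi.single κ (Matrix.single α β 1))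
    {X : Matrix (∀ i, U i) (∀ i, U i) F} (hX : X ∈ piKroneckerSpan C) :
    X - ∑ κ, ∑ α, ∑ β, piRepresentation φ X κ α β •
      piKronecker (fun i => B i (κ i) (α i) (β i)) ∈ ⨆ i, coordinateKernel C φ i := by
  induction hX using Submodule.span_induction with
  | zero => simp
  | add X Y _ _ hX hY =>
    convert! add_mem hX hY using 1
    simp only [map_add, Pi.add_apply, Matrix.add_apply, add_smul, Finset.sum_add_distrib]
    abel
  | smul c X _ hX =>
    convert! Submodule.smul_mem _ c hX using 1
    simp only [map_smul, Pi.smul_apply, Matrix.smul_apply, smul_sub, Finset.smul_sum, smul_assoc]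
  | mem X hX =>
    obtain ⟨M, hM, rfl⟩ := hX
    let S (i : ι) : Matrix (U i) (U i) F := ∑ κ, ∑ α, ∑ β, φ i (M i) κ α β • B i κ α β
    have hS : ∀ i, S i ∈ C i := fun i => sum_mem fun κ _ => sum_mem fun α _ => sum_mem fun β _ =>
      (C i).smul_mem (hBC i κ α β) _
    have hφS (i : ι) : φ i (S i) = φ i (M i) := by
      simp only [S, map_sum, map_smul, hB]
      funext κ
      ext α β
      simp only [Finset.sum_apply, Matrix.sum_apply, Pi.smul_apply, Matrix.smul_apply]
      rw [Finset.sum_eq_single κ]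
      · simp [Matrix.single_apply, ite_and]
      · intro κ' _ hne
        simp [Pi.single_eq_of_ne (Ne.symm hne)]
      · simp
    have hsum : (∑ κ, ∑ α, ∑ β, piRepresentation φ (piKronecker M) κ α β •
        piKronecker (fun i => B i (κ i) (α i) (β i))) = piKronecker S := by
      ext y z
      simp only [piRepresentation_piKronecker, Matrix.sum_apply, Matrix.smul_apply,
        piKronecker_apply, S, smul_eq_mul, Fintype.prod_sum, Finset.prod_mul_distrib]
    have hMS : M = fun i => S i + (M i - S i) := by
      funext i
      rw [add_sub_cancel]
    rw [hsum]
    nth_rw 1 [hMS]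
    -- Only the term `s = univ` has no factor `M i - S i`, and it is the one subtracted.
    rw [piKronecker_add, ← Finset.add_sum_erase _ _ (Finset.mem_univ Finset.univ),
      Finset.piecewise_univ, add_sub_cancel_left]
    refine sum_mem fun s hs => ?_
    obtain ⟨i, hi⟩ : ∃ i, i ∉ s := by
      by_contra! h
      exact (Finset.mem_erase.mp hs).1 (Finset.eq_univ_iff_forall.mpr h)
    refine Submodule.mem_iSup_of_mem i (Submodule.subset_span ⟨_, fun k => ?_, ?_, rfl⟩)
    · by_cases hk : k ∈ s
      · rw [Finset.piecewise_eq_of_mem _ _ _ hk]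
        exact hS k
      · rw [Finset.piecewise_eq_of_notMem _ _ _ hk]
        exact sub_mem (hM k) (hS k)
    · rw [Finset.piecewise_eq_of_notMem _ _ _ hi, map_sub, hφS, sub_self]

theorem exists_algHom_of_toSubmodule_eq_piKroneckerSpan
    {T : Subalgebra F (Matrix (∀ i, U i) (∀ i, U i) F)}
    (hT : Subalgebra.toSubmodule T = piKroneckerSpan C)
    (hone : ∀ i, φ i 1 = 1)
    (hmul : ∀ i, ∀ M ∈ C i, ∀ N ∈ C i, φ i (M * N) = φ i M * φ i N)
    (hsurj : ∀ i Y, ∃ M ∈ C i, φ i M = Y)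
    (hnil : ∀ i, ∀ L ∈ C i, ∀ M ∈ C i, ∀ N ∈ C i,
      φ i L = 0 → φ i M = 0 → φ i N = 0 → L * M * N = 0) :
    ∃ Φ : T →ₐ[F] ∀ κ : ∀ i, K i, Matrix (∀ i, J i (κ i)) (∀ i, J i (κ i)) F,
      Function.Surjective Φ ∧ ∀ a, Φ a = 0 → a ∈ Ring.jacobson T := by
  have hT' (X) : X ∈ T ↔ X ∈ piKroneckerSpan C := by rw [← hT, Subalgebra.mem_toSubmodule]
  choose B hBC hB using fun i κ α β => hsurj i (Pi.single κ (Matrix.single α β 1))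
  refine ⟨AlgHom.ofLinearMap ((piRepresentation φ).comp T.val.toLinearMap)
    (piRepresentation_one hone) fun X Y => piRepresentation_mul hmul ((hT' _).mp X.2)
      ((hT' _).mp Y.2), fun Y => ?_, fun X hX => ?_⟩
  · have hmem : ∑ κ, ∑ α, ∑ β, Y κ α β • piKronecker (fun i => B i (κ i) (α i) (β i)) ∈ T :=
      sum_mem fun κ _ => sum_mem fun α _ => sum_mem fun β _ => T.smul_mem
        ((hT' _).mpr (Submodule.subset_span ⟨_, fun i => hBC i _ _ _, rfl⟩)) _
    refine ⟨⟨_, hmem⟩, ?_⟩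
    change piRepresentation φ (∑ κ, ∑ α, ∑ β, Y κ α β •
      piKronecker fun i => B i (κ i) (α i) (β i)) = Y
    simp only [map_sum, map_smul,
      piRepresentation_piKronecker_eq_single (fun i => hB i _ _ _)]
    funext κ
    ext α β
    simp only [Finset.sum_apply, Matrix.sum_apply, Pi.smul_apply, Matrix.smul_apply]
    rw [Finset.sum_eq_single κ]
    · simp [Matrix.single_apply, ite_and]
    · intro κ' _ hne
      simp [Pi.single_eq_of_ne (Ne.symm hne)]
    · simp
  · have h0 : piRepresentation φ (X : Matrix (∀ i, U i) (∀ i, U i) F) = 0 := hX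
    have h := sub_sum_mem_iSup_coordinateKernel hBC hB ((hT' _).mp X.2)
    simp only [h0, Pi.zero_apply, Matrix.zero_apply, zero_smul, Finset.sum_const_zero,
      sub_zero] at h
    have hle (i : ι) : coordinateKernel C φ i ≤ piKroneckerSpan C :=
      Submodule.span_mono fun _ ⟨M, hM, _, hX⟩ => ⟨M, hM, hX⟩
    -- The radical is closed under sums, so nilpotency is needed only within each single coordinate
    -- kernel.
    suffices ∀ X ∈ ⨆ i, coordinateKernel C φ i, ∃ h : X ∈ T, ⟨X, h⟩ ∈ Ring.jacobson T from
      (this _ h).2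
    intro X hX
    induction hX using Submodule.iSup_induction' with
    | zero => exact ⟨T.zero_mem, (Ring.jacobson T).zero_mem⟩
    | add X Y _ _ hX hY =>
      exact ⟨T.add_mem hX.1 hY.1, (Ring.jacobson T).add_mem hX.2 hY.2⟩
    | mem i X hX =>
      refine ⟨(hT' _).mpr (hle i hX), mem_ringJacobson_of_forall_isNilpotent fun Y => ⟨3, ?_⟩⟩
      exact Subtype.ext (pow_three_eq_zero_of_mem_coordinateKernel (hnil i)
        (mul_mem_coordinateKernel hmul ((hT' _).mp Y.2) hX))

end PiKronecker

/-! ### The algebra of a single coordinate and its semisimple quotient -/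

section Star

variable {U : Type*} [DecidableEq U] {F : Type*} [Field F]

/-- The matrix which is constant on each of the sets `y = x = z`, `y = x ≠ z`, `y ≠ x = z`,
`x ≠ y ≠ z ≠ x`, `y = z ≠ x`, with values `a`, `b`, `c`, `d` and `d + e`. -/
def starMatrix (x : U) (a b c d e : F) : Matrix U U F :=
  Matrix.of fun y z =>
    if y = x then (if z = x then a else b) else if z = x then c else d + if y = z then e else 0

theorem starMatrix_apply (x : U) (a b c d e : F) (y z : U) : starMatrix x a b c d e y z =
    if y = x then (if z = x then a else b) else if z = x then c else d + if y = z then e else 0 :=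
  rfl

theorem starMatrix_add (x : U) (a b c d e a' b' c' d' e' : F) :
    starMatrix x a b c d e + starMatrix x a' b' c' d' e' =
      starMatrix x (a + a') (b + b') (c + c') (d + d') (e + e') := by
  ext y z
  simp only [Matrix.add_apply, starMatrix_apply]
  split_ifs <;> ring

theorem starMatrix_zero (x : U) : starMatrix x 0 0 0 0 (0 : F) = 0 := by
  ext y z
  simp [starMatrix_apply]

variable [Fintype U]

theorem algebraMap_eq_starMatrix (x : U) (r : F) :
    algebraMap F (Matrix U U F) r = starMatrix x r 0 0 0 r := by
  ext y z
  rw [Matrix.algebraMap_matrix_apply, starMatrix_apply]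
  by_cases hy : y = x <;> by_cases hz : z = x <;> by_cases hyz : y = z <;> simp_all

theorem sum_erase_ite_eq {x z : U} (hz : z ≠ x) (f : F) :
    ∑ w ∈ Finset.univ.erase x, (if w = z then f else 0) = f := by
  rw [Finset.sum_ite_eq', if_pos (by simp [hz])]

/-- The middle point is either `x` or one of the `u - 1` others. The characteristic of `F` enters
only through this factor `u - 1`. -/
theorem starMatrix_mul (x : U) (a b c d e a' b' c' d' e' : F) :
    starMatrix x a b c d e * starMatrix x a' b' c' d' e' =
      starMatrix x (a * a' + (Fintype.card U - 1 : ℕ) * (b * c'))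
        (a * b' + (Fintype.card U - 1 : ℕ) * (b * d') + b * e')
        (c * a' + (Fintype.card U - 1 : ℕ) * (d * c') + e * c')
        (c * b' + (Fintype.card U - 1 : ℕ) * (d * d') + d * e' + e * d') (e * e') := by
  ext y z
  have hc : (Finset.univ.erase x).card = Fintype.card U - 1 := by
    rw [Finset.card_erase_of_mem (Finset.mem_univ x), Finset.card_univ]
  have hsum (g : U → F) (f : F) (hg : ∀ w, w ≠ x → g w = f) :
      ∑ w ∈ Finset.univ.erase x, g w = (Fintype.card U - 1 : ℕ) * f := by
    rw [Finset.sum_congr rfl fun w hw => hg w (Finset.ne_of_mem_erase hw), Finset.sum_const, hc,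
      nsmul_eq_mul]
  rw [Matrix.mul_apply, ← Finset.add_sum_erase _ _ (Finset.mem_univ x)]
  by_cases hy : y = x
  · subst hy
    by_cases hz : z = y
    · subst hz
      rw [hsum _ (b * c') fun w hw => by simp [starMatrix_apply, hw]]
      simp [starMatrix_apply]
    · have (w) (hw : w ∈ Finset.univ.erase y) : starMatrix y a b c d e y w *
          starMatrix y a' b' c' d' e' w z = b * d' + if w = z then b * e' else 0 := by
        simp only [starMatrix_apply, if_neg (Finset.ne_of_mem_erase hw), hz, if_false, if_true]
        split_ifs <;> ring
      rw [Finset.sum_congr rfl this, Finset.sum_add_distrib, hsum _ _ fun _ _ => rfl,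
        sum_erase_ite_eq hz]
      simp only [starMatrix_apply, if_true, hz, if_false]
      ring
  · by_cases hz : z = x
    · subst hz
      have (w) (hw : w ∈ Finset.univ.erase z) : starMatrix z a b c d e y w *
          starMatrix z a' b' c' d' e' w z = d * c' + if w = y then e * c' else 0 := by
        simp only [starMatrix_apply, if_neg (Finset.ne_of_mem_erase hw), hy, if_false, if_true,
          eq_comm (a := y)]
        split_ifs <;> ring
      rw [Finset.sum_congr rfl this, Finset.sum_add_distrib, hsum _ _ fun _ _ => rfl,
        sum_erase_ite_eq hy]
      simp only [starMatrix_apply, if_true, hy, if_false]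
      ring
    · have (w) (hw : w ∈ Finset.univ.erase x) : starMatrix x a b c d e y w *
          starMatrix x a' b' c' d' e' w z = d * d' + (if w = z then d * e' else 0) +
            (if w = y then e * d' else 0) + if w = y then (if y = z then e * e' else 0) else 0 := by
        simp only [starMatrix_apply, if_neg (Finset.ne_of_mem_erase hw), hy, hz, if_false,
          eq_comm (a := y) (b := w)]
        by_cases h1 : w = y
        · subst h1
          simp only [if_true]
          split_ifs <;> ring
        · simp only [h1, if_false]
          split_ifs <;> ring
      rw [Finset.sum_congr rfl this, Finset.sum_add_distrib, Finset.sum_add_distrib,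
        Finset.sum_add_distrib, hsum _ _ fun _ _ => rfl, sum_erase_ite_eq hz, sum_erase_ite_eq hy,
        sum_erase_ite_eq hy]
      simp only [starMatrix_apply, if_true, hy, hz, if_false]
      ring

/-- The algebra of all the matrices `starMatrix x a b c d e`. -/
def starAlgebra (F : Type*) [Field F] (x : U) : Subalgebra F (Matrix U U F) where
  carrier := {M | ∃ a b c d e, M = starMatrix x a b c d e}
  add_mem' := by
    rintro _ _ ⟨a, b, c, d, e, rfl⟩ ⟨a', b', c', d', e', rfl⟩
    exact ⟨_, _, _, _, _, starMatrix_add ..⟩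
  mul_mem' := by
    rintro _ _ ⟨a, b, c, d, e, rfl⟩ ⟨a', b', c', d', e', rfl⟩
    exact ⟨_, _, _, _, _, starMatrix_mul ..⟩
  algebraMap_mem' r := ⟨_, _, _, _, _, algebraMap_eq_starMatrix x r⟩

theorem starMatrix_mem (x : U) (a b c d e : F) : starMatrix x a b c d e ∈ starAlgebra F x :=
  ⟨_, _, _, _, _, rfl⟩

/-- The labels of the simple components of the semisimple quotient of `starAlgebra`. -/
abbrev StarBlock (U : Type*) [Fintype U] : Type := {κ : Bool // κ = true → 2 < Fintype.card U}

/-- The row indices of a simple component of the semisimple quotient of `starAlgebra`. -/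
abbrev StarIndex (U : Type*) [Fintype U] (F : Type*) [Field F] (κ : StarBlock U) : Type :=
  {α : Bool // (κ.1 = true → α = true) ∧
    (((Fintype.card U - 1 : ℕ) : F) = 0 → α = true → κ.1 = true)}

noncomputable instance (κ : StarBlock U) : Fintype (StarIndex U F κ) := Fintype.ofFinite _

instance (κ : StarBlock U) : Nonempty (StarIndex U F κ) := ⟨⟨κ.1, id, fun _ => id⟩⟩

/-- The linear map which restricts to the projection of `starAlgebra` onto its semisimple
quotient, computed with the help of two distinct points `p`, `q` different from `x`. -/
def starRepresentation (F : Type*) [Field F] (x p q : U) :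
    Matrix U U F →ₗ[F] ∀ κ : StarBlock U, Matrix (StarIndex U F κ) (StarIndex U F κ) F where
  toFun M κ := Matrix.of fun α β =>
    if κ.1 then M p p - M p q else
      if β.1 then ∑ z ∈ Finset.univ.erase x, M (if α.1 then p else x) z
      else M (if α.1 then p else x) x
  map_add' M N := by
    funext κ
    ext α β
    simp only [Matrix.of_apply, Matrix.add_apply, Pi.add_apply, Finset.sum_add_distrib]
    split_ifs <;> ring
  map_smul' c M := by
    funext κ
    ext α β
    simp only [Matrix.of_apply, Matrix.smul_apply, Pi.smul_apply, smul_eq_mul, ← Finset.mul_sum,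
      RingHom.id_apply]
    split_ifs <;> ring

variable {x p q : U} (hp : p ≠ x) (hq : 2 < Fintype.card U → q ≠ x ∧ p ≠ q)
include hp hq

/-- The block `false` is the action on `x` and on the indicator of its complement; the block `true`
is the scalar action on sum-zero vectors supported off `x`. If `u - 1 = 0` the former is triangular
with diagonal `a`, `e`; as `e` already has its own block, `StarIndex` keeps only the index `false`.
-/
theorem starRepresentation_starMatrix (a b c d e : F) (κ : StarBlock U) (α β : StarIndex U F κ) :
    starRepresentation F x p q (starMatrix x a b c d e) κ α β =
      if κ.1 then e else
        if α.1 then (if β.1 then (Fintype.card U - 1 : ℕ) * d + e else c)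
        else (if β.1 then (Fintype.card U - 1 : ℕ) * b else a) := by
  have hc : (Finset.univ.erase x).card = Fintype.card U - 1 := by
    rw [Finset.card_erase_of_mem (Finset.mem_univ x), Finset.card_univ]
  have h1 : ∑ z ∈ Finset.univ.erase x, starMatrix x a b c d e x z =
      (Fintype.card U - 1 : ℕ) * b := by
    rw [Finset.sum_congr rfl fun z hz => (by simp [starMatrix_apply, Finset.ne_of_mem_erase hz] :
      starMatrix x a b c d e x z = b), Finset.sum_const, hc, nsmul_eq_mul]
  have h2 : ∑ z ∈ Finset.univ.erase x, starMatrix x a b c d e p z =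
      (Fintype.card U - 1 : ℕ) * d + e := by
    rw [Finset.sum_congr rfl fun z hz => (by
      simp [starMatrix_apply, Finset.ne_of_mem_erase hz, hp, eq_comm] :
      starMatrix x a b c d e p z = d + if z = p then e else 0), Finset.sum_add_distrib,
      sum_erase_ite_eq hp, Finset.sum_const, hc, nsmul_eq_mul]
  rw [starRepresentation, LinearMap.coe_mk, AddHom.coe_mk, Matrix.of_apply]
  obtain ⟨_ | _, hκ⟩ := κ
  · obtain ⟨_ | _, hα⟩ := α <;> obtain ⟨_ | _, hβ⟩ := β <;>
      simp only [if_true, Bool.false_eq_true, if_false, h1, h2] <;> simp [starMatrix_apply, hp]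
  · obtain ⟨h3, h4⟩ := hq (hκ rfl)
    simp [starMatrix_apply, hp, h3, h4]

theorem starRepresentation_one : starRepresentation F x p q 1 = 1 := by
  rw [← map_one (algebraMap F (Matrix U U F)), algebraMap_eq_starMatrix x]
  funext κ
  ext α β
  rw [starRepresentation_starMatrix hp hq]
  obtain ⟨_ | _, hκ⟩ := κ
  · obtain ⟨_ | _, hα⟩ := α <;> obtain ⟨_ | _, hβ⟩ := β <;> simp
  · obtain ⟨_ | _, hα⟩ := α <;> obtain ⟨_ | _, hβ⟩ := β <;> simp_all [Matrix.one_apply]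

/-- Dropping the index `true` when `u - 1 = 0` is harmless: the missing summand has the factor `(u -
1) * b`. -/
theorem starRepresentation_mul {M N : Matrix U U F} (hM : M ∈ starAlgebra F x)
    (hN : N ∈ starAlgebra F x) : starRepresentation F x p q (M * N) =
      starRepresentation F x p q M * starRepresentation F x p q N := by
  classical
  obtain ⟨a, b, c, d, e, rfl⟩ := hM
  obtain ⟨a', b', c', d', e', rfl⟩ := hN
  have hsum (κ : StarBlock U) (f : Bool → F) : ∑ γ : StarIndex U F κ, f γ.1 =
      ∑ γ : Bool, if (κ.1 = true → γ = true) ∧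
        (((Fintype.card U - 1 : ℕ) : F) = 0 → γ = true → κ.1 = true) then f γ else 0 := by
    rw [← Finset.sum_filter]
    exact (Finset.sum_subtype _ (by simp) f).symm
  funext κ
  ext α β
  rw [starMatrix_mul, starRepresentation_starMatrix hp hq, Pi.mul_apply, Matrix.mul_apply]
  simp only [starRepresentation_starMatrix hp hq]
  rw [hsum κ fun γ => (if κ.1 then e else
        if α.1 then (if γ then (Fintype.card U - 1 : ℕ) * d + e else c)
        else (if γ then (Fintype.card U - 1 : ℕ) * b else a)) * (if κ.1 then e' else
        if γ then (if β.1 then (Fintype.card U - 1 : ℕ) * d' + e' else c')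
        else (if β.1 then (Fintype.card U - 1 : ℕ) * b' else a')), Fintype.sum_bool]
  clear hsum
  obtain ⟨_ | _, hκ⟩ := κ
  · by_cases hr : ((Fintype.card U - 1 : ℕ) : F) = 0
    · obtain ⟨_ | _, hα⟩ := α
      · obtain ⟨_ | _, hβ⟩ := β
        · simp [hr]
        · exact absurd (hβ.2 hr rfl) Bool.false_ne_true
      · exact absurd (hα.2 hr rfl) Bool.false_ne_true
    · obtain ⟨_ | _, hα⟩ := α <;> obtain ⟨_ | _, hβ⟩ := β <;> simp [hr] <;> ring
  · simp

theorem exists_starRepresentation_eq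
    (Y : ∀ κ : StarBlock U, Matrix (StarIndex U F κ) (StarIndex U F κ) F) :
    ∃ M ∈ starAlgebra F x, starRepresentation F x p q M = Y := by
  classical
  let P (k s : Bool) : Prop :=
    (k = true → s = true) ∧ (((Fintype.card U - 1 : ℕ) : F) = 0 → s = true → k = true)
  -- Extending `Y` by zero to all Booleans avoids dependent indices. In particular `y true true true
  -- = 0` when `u = 2`.
  let y (k s t : Bool) : F :=
    if h : (k = true → 2 < Fintype.card U) ∧ P k s ∧ P k t then
      Y ⟨k, h.1⟩ ⟨s, h.2.1⟩ ⟨t, h.2.2⟩ else 0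
  have hy (κ : StarBlock U) (α β : StarIndex U F κ) : Y κ α β = y κ.1 α.1 β.1 := by
    have h : (κ.1 = true → 2 < Fintype.card U) ∧ P κ.1 α.1 ∧ P κ.1 β.1 := ⟨κ.2, α.2, β.2⟩
    simp only [y, dif_pos h]
  clear_value y
  -- The entries `a`, `(u - 1) * b`, `c`, `(u - 1) * d + e` and `e` are solved for the parameters;
  -- if `u - 1 = 0`, the entries involving an inverse are not indexed.
  refine ⟨_, starMatrix_mem x (y false false false)
    (((Fintype.card U - 1 : ℕ) : F)⁻¹ * y false false true) (y false true false)
    (((Fintype.card U - 1 : ℕ) : F)⁻¹ * (y false true true - y true true true))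
    (y true true true), ?_⟩
  funext κ
  ext α β
  rw [starRepresentation_starMatrix hp hq, hy]
  clear hy
  obtain ⟨_ | _, hκ⟩ := κ
  · by_cases hr : ((Fintype.card U - 1 : ℕ) : F) = 0
    · obtain ⟨_ | _, hα⟩ := α
      · obtain ⟨_ | _, hβ⟩ := β
        · rfl
        · exact absurd (hβ.2 hr rfl) Bool.false_ne_true
      · exact absurd (hα.2 hr rfl) Bool.false_ne_true
    · obtain ⟨_ | _, hα⟩ := α <;> obtain ⟨_ | _, hβ⟩ := β <;>
        simp [hr]
  · obtain ⟨α, hα⟩ := α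
    obtain ⟨β, hβ⟩ := β
    obtain rfl := hα.1 rfl
    obtain rfl := hβ.1 rfl
    rfl

theorem eq_zero_or_of_starRepresentation_eq_zero (hU : 2 ≤ Fintype.card U) {M : Matrix U U F}
    (hM : M ∈ starAlgebra F x) (h0 : starRepresentation F x p q M = 0) :
    M = 0 ∨ ((Fintype.card U - 1 : ℕ) : F) = 0 ∧ ∃ b c d, M = starMatrix x 0 b c d 0 := by
  obtain ⟨a, b, c, d, e, rfl⟩ := hM
  have h (κ : StarBlock U) (α β : StarIndex U F κ) :=
    (starRepresentation_starMatrix hp hq a b c d e κ α β).symm.trans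
      (congrFun (congrFun (congrFun h0 κ) α) β)
  have ha : a = 0 := h ⟨false, by simp⟩ ⟨false, by simp⟩ ⟨false, by simp⟩
  have he (hc : 2 < Fintype.card U) : e = 0 :=
    h ⟨true, fun _ => hc⟩ ⟨true, by simp⟩ ⟨true, by simp⟩
  by_cases hr : ((Fintype.card U - 1 : ℕ) : F) = 0
  · have hc : 2 < Fintype.card U := by
      refine lt_of_le_of_ne hU fun hc => ?_
      rw [← hc] at hr
      simp at hr
    exact Or.inr ⟨hr, b, c, d, by rw [ha, he hc]⟩
  · left
    have hb : (Fintype.card U - 1 : ℕ) * b = 0 :=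
      h ⟨false, by simp⟩ ⟨false, by simp⟩ ⟨true, by simp [hr]⟩
    have hc : c = 0 := h ⟨false, by simp⟩ ⟨true, by simp [hr]⟩ ⟨false, by simp⟩
    have hd : (Fintype.card U - 1 : ℕ) * d + e = 0 :=
      h ⟨false, by simp⟩ ⟨true, by simp [hr]⟩ ⟨true, by simp [hr]⟩
    replace hb := (mul_eq_zero.mp hb).resolve_left hr
    rcases hU.eq_or_lt with hcard | hcard
    -- For `u = 2` there is one point off `x`, so only `d + e` is visible, and `hd` says that it
    -- vanishes.
    · rw [← hcard] at hd
      ext y z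
      rw [starMatrix_apply, ha, hb, hc, Matrix.zero_apply]
      split_ifs with hy hz hz hyz
      · rfl
      · rfl
      · rfl
      · simpa using hd
      · exact absurd (Finset.two_lt_card.mpr
          ⟨x, Finset.mem_univ x, y, Finset.mem_univ y, z, Finset.mem_univ z, Ne.symm hy,
            Ne.symm hz, hyz⟩) (by rw [Finset.card_univ, ← hcard]; exact lt_irrefl 2)
    · rw [he hcard, add_zero] at hd
      rw [ha, hb, hc, (mul_eq_zero.mp hd).resolve_left hr, he hcard, starMatrix_zero]

/-- When `u - 1 = 0`, a product of two kernel elements retains only the parameter `d`, with value `c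
* b'`; a third factor kills it. -/
theorem mul_mul_eq_zero_of_starRepresentation_eq_zero (hU : 2 ≤ Fintype.card U)
    {L M N : Matrix U U F} (hL : L ∈ starAlgebra F x) (hM : M ∈ starAlgebra F x)
    (hN : N ∈ starAlgebra F x) (hL0 : starRepresentation F x p q L = 0)
    (hM0 : starRepresentation F x p q M = 0) (hN0 : starRepresentation F x p q N = 0) :
    L * M * N = 0 := by
  obtain rfl | ⟨hr, b, c, d, rfl⟩ := eq_zero_or_of_starRepresentation_eq_zero hp hq hU hL hL0
  · simp
  obtain rfl | ⟨-, b', c', d', rfl⟩ := eq_zero_or_of_starRepresentation_eq_zero hp hq hU hM hM0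
  · simp
  obtain rfl | ⟨-, b'', c'', d'', rfl⟩ := eq_zero_or_of_starRepresentation_eq_zero hp hq hU hN hN0
  · simp
  simp [starMatrix_mul, hr, starMatrix_zero]

end Star

/-! ### Indicator matrices of equality patterns -/

section Indicator

variable {U : Type*} [DecidableEq U] {F : Type*} [Field F]

/-- The indicator matrix of a set of pairs defined by the equality pattern of `x`, `y`, `z`. -/
def patternMatrix (F : Type*) [Field F] (x : U) (t : Bool × Bool × Bool) : Matrix U U F :=
  Matrix.of fun y z => if (decide (x ≠ y), decide (y ≠ z), decide (x ≠ z)) = t then 1 else 0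

theorem exists_eq_sum_patternMatrix [Fintype U] {x : U} {M : Matrix U U F}
    (hM : M ∈ starAlgebra F x) :
    ∃ m : Bool × Bool × Bool → F, M = ∑ t, m t • patternMatrix F x t := by
  obtain ⟨a, b, c, d, e, rfl⟩ := hM
  -- Inconsistent patterns have zero indicator, so their coefficients are arbitrary.
  refine ⟨fun t => if t.1 then (if t.2.2 then d + (if t.2.1 then 0 else e) else c)
    else (if t.2.2 then b else a), ?_⟩
  ext y z
  simp only [Matrix.sum_apply, Matrix.smul_apply, patternMatrix, Matrix.of_apply, smul_eq_mul,
    mul_ite, mul_one, mul_zero, Finset.sum_ite_eq, Finset.mem_univ, if_true, starMatrix_apply]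
  by_cases hy : y = x <;> by_cases hz : z = x <;> by_cases hyz : y = z <;>
    simp [hy, hz, hyz, Ne.symm]

theorem piKronecker_sum_smul {ι : Type*} [Fintype ι] [DecidableEq ι] {κ : Type*} [Fintype κ]
    {U : ι → Type*} (m : ι → κ → F) (M : ∀ i, κ → Matrix (U i) (U i) F) :
    piKronecker (fun i => ∑ t, m i t • M i t) =
      ∑ τ : ι → κ, (∏ i, m i (τ i)) • piKronecker fun i => M i (τ i) := by
  ext y z
  simp only [piKronecker_apply, Matrix.sum_apply, Matrix.smul_apply, smul_eq_mul,
    Fintype.prod_sum, Finset.prod_mul_distrib]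

theorem dualIdempotent_eq_diagonal {X I : Type*} [DecidableEq X] (R : I → X → X → Prop) (x : X)
    (g : I) [DecidablePred (R g x)] :
    dualIdempotent F R x g = Matrix.diagonal fun y => if R g x y then 1 else 0 := by
  unfold dualIdempotent
  congr!

end Indicator

/-! ### The Terwilliger algebra as a tensor product -/

namespace FactorialScheme

variable {n : ℕ} {U : Fin n → Type u}

section Algebra

variable [∀ i, DecidableEq (U i)] {F : Type v} [Field F]

theorem dualIdempotent_eq_piKronecker (x : ∀ i, U i) (g : Finset (Fin n)) :
    dualIdempotent F (rel U) x g = piKronecker fun i =>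
      if i ∈ g then starMatrix (x i) 0 0 0 0 1 else starMatrix (x i) 1 0 0 0 0 := by
  classical
  ext y z
  have h (i : Fin n) : (if i ∈ g then starMatrix (x i) 0 0 0 0 1
      else starMatrix (x i) 1 0 0 0 0 : Matrix (U i) (U i) F) (y i) (z i) =
      if y i = z i ∧ (x i ≠ y i ↔ i ∈ g) then 1 else 0 := by
    by_cases hg : i ∈ g <;> by_cases hy : y i = x i <;> by_cases hz : z i = x i <;>
      by_cases hyz : y i = z i <;> simp_all [starMatrix_apply, eq_comm]
  rw [piKronecker_apply, Finset.prod_congr rfl fun i _ => h i, Finset.prod_ite_zero,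
    Finset.prod_const_one, dualIdempotent_eq_diagonal, Matrix.diagonal_apply, ← ite_and]
  congr 1
  simp only [Finset.mem_univ, true_imp_iff, forall_and, funext_iff, rel]

/-- The factors are `J - 1` (`J` all-ones) at the coordinates in `g` and `1` elsewhere. -/
theorem adjacencyMatrix_eq_piKronecker (x : ∀ i, U i) (g : Finset (Fin n)) :
    adjacencyMatrix F (rel U) g = piKronecker fun i =>
      if i ∈ g then starMatrix (x i) 0 1 1 1 (-1) else starMatrix (x i) 1 0 0 0 1 := by
  classical
  ext y z
  have h (i : Fin n) : (if i ∈ g then starMatrix (x i) 0 1 1 1 (-1)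
      else starMatrix (x i) 1 0 0 0 1 : Matrix (U i) (U i) F) (y i) (z i) =
      if (y i ≠ z i ↔ i ∈ g) then 1 else 0 := by
    by_cases hg : i ∈ g <;> by_cases hy : y i = x i <;> by_cases hz : z i = x i <;>
      by_cases hyz : y i = z i <;> simp_all [starMatrix_apply]
  rw [piKronecker_apply, Finset.prod_congr rfl fun i _ => h i, Finset.prod_ite_zero,
    Finset.prod_const_one, adjacencyMatrix, Matrix.of_apply]
  congr 1
  simp only [Finset.mem_univ, true_imp_iff, rel]

variable [∀ i, Fintype (U i)]

/-- An equality pattern at every coordinate amounts to three subsets of coordinates, that is, to one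
triple product `E_g^* A_h E_k^*`. This puts every Kronecker product of star matrices into `T`. -/
theorem piKronecker_patternMatrix (x : ∀ i, U i) (τ : Fin n → Bool × Bool × Bool) :
    (piKronecker fun i => patternMatrix F (x i) (τ i)) =
      dualIdempotent F (rel U) x (Finset.univ.filter fun i => (τ i).1) *
        adjacencyMatrix F (rel U) (Finset.univ.filter fun i => (τ i).2.1) *
        dualIdempotent F (rel U) x (Finset.univ.filter fun i => (τ i).2.2) := by
  classical
  ext y z
  have hb (P : Prop) [Decidable P] (b : Bool) : decide P = b ↔ (P ↔ b = true) := by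
    cases b <;> simp
  rw [dualIdempotent_eq_diagonal, dualIdempotent_eq_diagonal, Matrix.mul_diagonal,
    Matrix.diagonal_mul, adjacencyMatrix, Matrix.of_apply]
  simp only [piKronecker_apply, patternMatrix, Matrix.of_apply, Finset.prod_ite_zero,
    Finset.prod_const_one, ← ite_and, mul_ite, mul_one, mul_zero]
  congr 1
  simp only [rel, Finset.mem_filter, Finset.mem_univ, true_and, true_imp_iff, Prod.ext_iff,
    forall_and, hb, eq_iff_iff]
  tauto

theorem toSubmodule_algebra (x : ∀ i, U i) :
    Subalgebra.toSubmodule (algebra F x) = piKroneckerSpan fun i => starAlgebra F (x i) := by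
  have hmem (M : ∀ i, Matrix (U i) (U i) F) (hM : ∀ i, M i ∈ starAlgebra F (x i)) :
      piKronecker M ∈ piKroneckerSpan fun i => starAlgebra F (x i) :=
    Submodule.subset_span ⟨M, hM, rfl⟩
  apply le_antisymm
  · let S : Subalgebra F (Matrix (∀ i, U i) (∀ i, U i) F) :=
      (piKroneckerSpan fun i => starAlgebra F (x i)).toSubalgebra
        (by
          rw [← piKronecker_one]
          exact hmem _ fun i => (starAlgebra F (x i)).one_mem)
        (by
          intro X Y hX hY
          have h := Submodule.mul_mem_mul hX hY
          rw [piKroneckerSpan, Submodule.span_mul_span] at h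
          refine Submodule.span_mono ?_ h
          rintro _ ⟨_, ⟨M, hM, rfl⟩, _, ⟨N, hN, rfl⟩, rfl⟩
          exact ⟨_, fun i => mul_mem (hM i) (hN i), (piKronecker_mul M N).symm⟩)
    suffices algebra F x ≤ S from this
    refine Algebra.adjoin_le ?_
    rintro _ (⟨g, rfl⟩ | ⟨g, rfl⟩)
    · rw [dualIdempotent_eq_piKronecker]
      refine hmem _ fun i => ?_
      split_ifs <;> exact starMatrix_mem ..
    · rw [adjacencyMatrix_eq_piKronecker x]
      refine hmem _ fun i => ?_
      split_ifs <;> exact starMatrix_mem ..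
  · refine Submodule.span_le.mpr ?_
    rintro _ ⟨M, hM, rfl⟩
    choose m hm using fun i => exists_eq_sum_patternMatrix (hM i)
    rw [funext hm, piKronecker_sum_smul]
    refine sum_mem fun τ _ => Submodule.smul_mem _ _ ?_
    rw [piKronecker_patternMatrix]
    have hE (g) : dualIdempotent F (rel U) x g ∈ algebra F x :=
      Algebra.subset_adjoin (Or.inl ⟨g, rfl⟩)
    have hA (g) : adjacencyMatrix F (rel U) g ∈ algebra F x :=
      Algebra.subset_adjoin (Or.inr ⟨g, rfl⟩)
    exact (algebra F x).mul_mem ((algebra F x).mul_mem (hE _) (hA _)) (hE _)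

theorem exists_algHom (hU : ∀ i, 2 ≤ Fintype.card (U i)) (x : ∀ i, U i) :
    ∃ Φ : algebra F x →ₐ[F] ∀ κ : ∀ i, StarBlock (U i),
        Matrix (∀ i, StarIndex (U i) F (κ i)) (∀ i, StarIndex (U i) F (κ i)) F,
      Function.Surjective Φ ∧ ∀ a, Φ a = 0 → a ∈ Ring.jacobson (algebra F x) := by
  have hp (i) : ∃ p, p ≠ x i := by
    have : Nontrivial (U i) := Fintype.one_lt_card_iff_nontrivial.mp (hU i)
    exact exists_ne (x i)
  choose p hp using hp
  have hq (i) : ∃ q, 2 < Fintype.card (U i) → q ≠ x i ∧ p i ≠ q := by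
    by_cases h : 2 < Fintype.card (U i)
    · obtain ⟨q, hq⟩ := Finset.exists_mem_notMem_of_card_lt_card
        (s := {x i, p i}) (t := Finset.univ) (Finset.card_le_two.trans_lt h)
      refine ⟨q, fun _ => ?_⟩
      simp only [Finset.mem_insert, Finset.mem_singleton, not_or] at hq
      exact ⟨hq.2.1, Ne.symm hq.2.2⟩
    -- A dummy value: without the block `true`, `q i` is never evaluated.
    · exact ⟨x i, fun h' => absurd h' h⟩
  choose q hq using hq
  exact exists_algHom_of_toSubmodule_eq_piKroneckerSpan
    (φ := fun i => starRepresentation F (x i) (p i) (q i)) (toSubmodule_algebra x)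
    (fun i => starRepresentation_one (hp i) (hq i))
    (fun i _ hM _ hN => starRepresentation_mul (hp i) (hq i) hM hN)
    (fun i => exists_starRepresentation_eq (hp i) (hq i))
    (fun i _ hL _ hM _ hN =>
      mul_mul_eq_zero_of_starRepresentation_eq_zero (hp i) (hq i) (hU i) hL hM hN)

theorem numIrreducibleModules_algebra (hU : ∀ i, 2 ≤ Fintype.card (U i)) (x : ∀ i, U i) :
    numIrreducibleModules (algebra F x) = Nat.card (∀ i, StarBlock (U i)) := by
  obtain ⟨Φ, hΦ, hker⟩ := exists_algHom (F := F) hU x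
  exact numIrreducibleModules_eq_card Φ.toRingHom hΦ hker fun κ => inferInstance

end Algebra

/-! ### Classes of triples as labels of the matrix blocks -/

section Triples

variable [∀ i, Fintype (U i)] {p : ℕ} {x : ∀ i, U i}

theorem valency_eq_prod (x : ∀ i, U i) (g : Finset (Fin n)) :
    valency (rel U) x g = ∏ i ∈ g, (Fintype.card (U i) - 1) := by
  classical
  have h : {y | rel U g x y} =
      (Fintype.piFinset fun i => if i ∈ g then Finset.univ.erase (x i) else {x i} : Set _) := by
    ext y
    simp only [rel, Set.mem_ofPred_eq, Finset.mem_coe, Fintype.mem_piFinset]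
    refine forall_congr' fun i => ?_
    split_ifs with hi <;> simp [hi, eq_comm]
  rw [valency, h, Set.ncard_coe_finset, Fintype.card_piFinset]
  rw [← Finset.prod_filter_mul_prod_filter_not Finset.univ (· ∈ g)]
  rw [Finset.filter_univ_mem, Finset.prod_congr rfl fun i hi => by
    rw [if_pos hi, Finset.card_erase_of_mem (Finset.mem_univ _), Finset.card_univ]]
  rw [Finset.prod_eq_one (s := Finset.univ.filter (· ∉ g)), mul_one]
  intro i hi
  rw [if_neg (Finset.mem_filter.mp hi).2, Finset.card_singleton]

theorem not_dvd_valency_iff (F : Type*) [Field F] [CharP F p] (x : ∀ i, U i)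
    (g : Finset (Fin n)) :
    ¬ p ∣ valency (rel U) x g ↔ ∀ i ∈ g, ((Fintype.card (U i) - 1 : ℕ) : F) ≠ 0 := by
  rw [← CharP.cast_eq_zero_iff F, valency_eq_prod, Nat.cast_prod, Finset.prod_eq_zero_iff]
  push Not
  rfl

/-- The label of the matrix component which belongs to a class of triples. -/
def classBlock (m : TripleClass p x) (i : Fin n) : StarBlock (U i) :=
  m.liftOn (fun t => ⟨decide (i ∈ tilde U (t.1.1 ∩ t.1.2.2) \ t.1.2.1), fun h =>
    (Finset.mem_filter.mp (Finset.mem_sdiff.mp (of_decide_eq_true h)).1).2⟩) fun s t h => by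
      have h' : tilde U (s.1.1 ∩ s.1.2.2) \ s.1.2.1 = tilde U (t.1.1 ∩ t.1.2.2) \ t.1.2.1 := h
      simp only [h']

theorem classBlock_mk (t : triples p x) (i : Fin n) :
    (classBlock (Quotient.mk (tripleSetoid p x) t) i).1 = true ↔
      i ∈ tilde U (t.1.1 ∩ t.1.2.2) \ t.1.2.1 :=
  decide_eq_true_iff

theorem classBlock_injective : Function.Injective (classBlock (p := p) (x := x)) := by
  intro m m' h
  induction m using Quotient.ind with | _ s =>
  induction m' using Quotient.ind with | _ t =>
  refine Quotient.sound (Finset.ext fun i => ?_)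
  rw [← classBlock_mk, ← classBlock_mk, h]

theorem classBlock_surjective (F : Type*) [Field F] [CharP F p] :
    Function.Surjective (classBlock (p := p) (x := x)) := by
  intro κ
  let s : Finset (Fin n) := Finset.univ.filter fun i => (κ i).1
  -- The empty middle set has valency 1, so this triple lies in `𝔻` in every characteristic.
  have hs : (s, (∅ : Finset (Fin n)), s) ∈ triples p x :=
    ⟨by simp [oplus], by simp [odot, oplus], (not_dvd_valency_iff F x ∅).mpr (by simp)⟩
  refine ⟨Quotient.mk _ ⟨_, hs⟩, funext fun i => Subtype.ext (Bool.eq_iff_iff.mpr ?_)⟩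
  rw [classBlock_mk]
  simp only [tilde, Finset.inter_self, Finset.sdiff_empty, Finset.mem_filter, s, Finset.mem_univ,
    true_and]
  exact ⟨And.left, fun h => ⟨h, (κ i).2 h⟩⟩

/-- The classes of triples are in bijection with the labels of the matrix components. -/
noncomputable def classEquiv (F : Type*) [Field F] [CharP F p] (x : ∀ i, U i) :
    TripleClass p x ≃ ∀ i, StarBlock (U i) :=
  Equiv.ofBijective classBlock ⟨classBlock_injective, classBlock_surjective F⟩

theorem mem_diagIndices_iff (hU : ∀ i, 2 ≤ Fintype.card (U i)) (F : Type*) [Field F] [CharP F p]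
    (m : TripleClass p x) (a : Finset (Fin n)) :
    a ∈ diagIndices p x m ↔ ∀ i, ((classBlock m i).1 = true → i ∈ a) ∧
      (((Fintype.card (U i) - 1 : ℕ) : F) = 0 → i ∈ a → (classBlock m i).1 = true) := by
  constructor
  · rintro ⟨b, hb, rfl⟩ i
    simp only [classBlock_mk, tilde, Finset.inter_self, Finset.mem_sdiff, Finset.mem_filter]
    refine ⟨fun h => h.1.1, fun h0 hi => ⟨⟨hi, lt_of_le_of_ne (hU i) fun hc => ?_⟩, fun hib => ?_⟩⟩
    · rw [← hc] at h0
      simp at h0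
    · exact (not_dvd_valency_iff F x b).mp hb.2.2 i hib h0
  · intro h
    let s : Finset (Fin n) := Finset.univ.filter fun i => (classBlock m i).1
    have hsmem (i) : i ∈ s ↔ (classBlock m i).1 = true := by simp [s]
    have hst (i) (hi : i ∈ s) : 2 < Fintype.card (U i) :=
      (classBlock m i).2 ((hsmem i).mp hi)
    -- The choice forced by `tilde U a \ b = s` and `b ⊆ tilde U a`; the second condition of `h`
    -- yields `p ∤ k_b`.
    have hb : (a, tilde U a \ s, a) ∈ triples p x := by
      refine ⟨?_, ?_, (not_dvd_valency_iff F x _).mpr ?_⟩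
      · intro i
        simp only [oplus, tilde, Finset.mem_union, Finset.mem_sdiff, Finset.mem_filter]
        tauto
      · intro i
        simp only [odot, oplus, tilde, Finset.mem_union, Finset.mem_sdiff, Finset.mem_filter,
          Finset.mem_inter]
        tauto
      · intro i hi h0
        simp only [tilde, Finset.mem_sdiff, Finset.mem_filter] at hi
        exact hi.2 ((hsmem i).mpr ((h i).2 h0 hi.1.1))
    refine ⟨_, hb, classBlock_injective (funext fun i => Subtype.ext (Bool.eq_iff_iff.mpr ?_))⟩
    rw [classBlock_mk, ← hsmem]
    simp only [tilde, Finset.inter_self, Finset.mem_sdiff, Finset.mem_filter]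
    have h1 := hst i
    have h2 := (h i).1
    rw [← hsmem] at h2
    tauto

/-- A row index of the block is a Boolean per coordinate, hence the characteristic function of a set
`a`; the constraints in `StarIndex` are those of `mem_diagIndices_iff`. -/
theorem ncard_diagIndices (hU : ∀ i, 2 ≤ Fintype.card (U i)) (F : Type*) [Field F] [CharP F p]
    (m : TripleClass p x) :
    Fintype.card (∀ i, StarIndex (U i) F (classBlock m i)) = (diagIndices p x m).ncard := by
  rw [← Nat.card_eq_fintype_card]
  refine Nat.card_congr
    { toFun α := ⟨Finset.univ.filter fun i => (α i).1, (mem_diagIndices_iff hU F m _).mpr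
        fun i => by simpa using (α i).2⟩
      invFun a i := ⟨decide (i ∈ a.1), by simpa using (mem_diagIndices_iff hU F m _).mp a.2 i⟩
      left_inv α := by
        funext i
        simp
      right_inv a := by
        ext i
        simp }

end Triples

end FactorialScheme

/-! ### The main theorem -/

theorem theorem9p13 {n : ℕ} (hn : 1 ≤ n) (U : Fin n → Type u)
    [∀ i, Fintype (U i)] [∀ i, DecidableEq (U i)] (hU : ∀ i, 2 ≤ Fintype.card (U i))
    (x : ∀ i, U i) (F : Type v) [Field F] (p : ℕ) [CharP F p] :
    Nonempty
      ((FactorialScheme.algebra F x ⧸ Ring.jacobson (FactorialScheme.algebra F x)) ≃ₐ[F]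
        (∀ m : FactorialScheme.TripleClass p x,
          Matrix (Fin (FactorialScheme.diagIndices p x m).ncard)
            (Fin (FactorialScheme.diagIndices p x m).ncard) F)) ∧
    numIrreducibleModules (FactorialScheme.algebra F x) = FactorialScheme.numClasses p x ∧
    ∀ (K : Type w) [Field K],
      numIrreducibleModules (FactorialScheme.algebra K x) =
        numIrreducibleModules (FactorialScheme.algebra F x) := by
  refine ⟨?_, ?_, fun K _ => ?_⟩
  · obtain ⟨Φ, hΦ, hker⟩ := FactorialScheme.exists_algHom (F := F) hU x
    obtain ⟨e⟩ := nonempty_quotient_ringJacobson_algEquiv Φ hΦ hker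
    refine ⟨(e.trans (AlgEquiv.piCongrLeft F _
      (FactorialScheme.classEquiv (p := p) F x)).symm).trans
        (AlgEquiv.piCongrRight fun m => Matrix.reindexAlgEquiv F F
          (Fintype.equivFinOfCardEq (FactorialScheme.ncard_diagIndices hU F m)))⟩
  · rw [FactorialScheme.numIrreducibleModules_algebra hU x, FactorialScheme.numClasses,
      Nat.card_congr (FactorialScheme.classEquiv (p := p) F x)]
  -- Both counts equal the number of block labels, which involve only the cardinalities of the `U
  -- i`.
  · rw [FactorialScheme.numIrreducibleModules_algebra hU x,
      FactorialScheme.numIrreducibleModules_algebra hU x]
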